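/- Let $A$ be an associative algebra over $\mathbb C$, with or without unit, with non-degenerate product, and let $M(A)$ denote its multiplier algebra. Let $(A,\Delta)$ be a regular multiplier Hopf algebra: $\Delta:A\to M(A\otimes A)$ is a non-degenerate coassociative homomorphism such that $\Delta(a)(1\otimes b)$, $(a\otimes 1)\Delta(b)$, $\Delta(a)(b\otimes 1)$ and $(1\otimes a)\Delta(b)$ lie in $A\otimes A$ for all $a,b\in A$, and there are a counit, that is, a homomorphism $\varepsilon:A\to\mathbb C$ with $(\varepsilon\otimes\iota)(\Delta(a)(1\otimes b))=ab=(\iota\otimes\varepsilon)((a\otimes 1)\Delta(b))$, and an invertible antipode, that is, a bijective linear anti-homomorphism $S:A\to A$ with $m(S\otimes\iota)(\Delta(a)(1\otimes b))=\varepsilon(a)b$ and $m(\iota\otimes S)((a\otimes 1)\Delta(b))=\varepsilon(b)a$, where $\iota$ is the identity map and $m$ is the multiplication. Assume that $(A,\Delta)$ is an algebraic quantum group, that is, it has a left integral $\varphi$ (a non-zero linear functional with $(\iota\otimes\varphi)\Delta(a)=\varphi(a)1$ in $M(A)$ for all $a\in A$), and let $\psi$ be a right integral (a non-zero linear functional with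 $(\psi\otimes\iota)\Delta(a)=\psi(a)1$ in $M(A)$ for all $a\in A$). Let $\sigma$ and $\sigma'$ be the modular automorphisms, that is, the algebra automorphisms of $A$ such that $$\varphi(ab)=\varphi(b\sigma(a)),\qquad \psi(ab)=\psi(b\sigma'(a))\qquad (a,b\in A),$$ and let $\delta\in M(A)$ be the modular element, that is, the element with $(\varphi\otimes\iota)\Delta(a)=\varphi(a)\delta$ for all $a\in A$. Then: - $\sigma\circ S\circ\sigma'=S$; - $\delta\,\sigma(a)=\sigma'(a)\,\delta$ in $M(A)$ for all $a\in A$; - $\Delta(\sigma(a))=(S^2\otimes\sigma)\Delta(a)$ for all $a\in A$, where the automorphism $S^2\otimes\sigma$ of $A\otimes A$ is extended to $M(A\otimes A)$. -/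

import Mathlib

open scoped TensorProduct

set_option linter.unusedSectionVars false

noncomputable section

namespace AlgQuantumGroup

/-! ### Multiplier algebras -/

section MultiplierAlgebra

variable (B : Type*) [NonUnitalRing B] [Module ℂ B] [IsScalarTower ℂ B B] [SMulCommClass ℂ B B]

/-- The product of `B` is non-degenerate. -/
structure NonDegenerate : Prop where
  eq_zero_of_mul_left : ∀ a : B, (∀ b : B, a * b = 0) → a = 0
  eq_zero_of_mul_right : ∀ a : B, (∀ b : B, b * a = 0) → a = 0

/-- The multiplier algebra `M(B)`: the algebra of double centralizers `m = (L, R)`, where `L` is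
the left multiplication `x ↦ m x` and `R` is the right multiplication `x ↦ x m`. Since the
product in `M(B)` is `x (m n) = (x m) n`, the right multiplications live in the opposite of the
algebra of linear endomorphisms. -/
def multiplierSubalgebra : Subalgebra ℂ (Module.End ℂ B × (Module.End ℂ B)ᵐᵒᵖ) where
  carrier := {m | (∀ x y : B, m.1 (x * y) = m.1 x * y) ∧
    (∀ x y : B, m.2.unop (x * y) = x * m.2.unop y) ∧
    (∀ x y : B, m.2.unop x * y = x * m.1 y)}
  mul_mem' := by
    rintro m n ⟨h1, h2, h3⟩ ⟨k1, k2, k3⟩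
    refine ⟨fun x y => ?_, fun x y => ?_, fun x y => ?_⟩
    · simp [k1, h1]
    · simp [h2, k2]
    · simp [h3, k3]
  add_mem' := by
    rintro m n ⟨h1, h2, h3⟩ ⟨k1, k2, k3⟩
    refine ⟨fun x y => ?_, fun x y => ?_, fun x y => ?_⟩
    · simp [k1, h1, add_mul]
    · simp [h2, k2, mul_add]
    · simp [h3, k3, add_mul, mul_add]
  algebraMap_mem' := by
    intro r
    refine ⟨fun x y => ?_, fun x y => ?_, fun x y => ?_⟩
    · simp [Algebra.algebraMap_eq_smul_one, smul_mul_assoc]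
    · simp [Algebra.algebraMap_eq_smul_one, mul_smul_comm]
    · simp [Algebra.algebraMap_eq_smul_one, smul_mul_assoc, mul_smul_comm]

/-- The multiplier algebra `M(B)`, a unital complex algebra. -/
abbrev Multiplier : Type _ := multiplierSubalgebra B

variable {B}

namespace Multiplier

/-- `m.left x` is `m x`. -/
def left (m : Multiplier B) : B →ₗ[ℂ] B := m.1.1

/-- `m.right x` is `x m`. -/
def right (m : Multiplier B) : B →ₗ[ℂ] B := m.1.2.unop

theorem left_mul_apply (m : Multiplier B) (x y : B) : m.left (x * y) = m.left x * y :=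
  m.2.1 x y

theorem right_mul_apply (m : Multiplier B) (x y : B) : m.right (x * y) = x * m.right y :=
  m.2.2.1 x y

theorem right_mul (m : Multiplier B) (x y : B) : m.right x * y = x * m.left y :=
  m.2.2.2 x y

/-- The multiplier with given left and right multiplication. -/
def mk (L R : B →ₗ[ℂ] B) (hL : ∀ x y, L (x * y) = L x * y) (hR : ∀ x y, R (x * y) = x * R y)
    (hRL : ∀ x y, R x * y = x * L y) : Multiplier B :=
  ⟨(L, MulOpposite.op R), hL, hR, hRL⟩

theorem ext {m n : Multiplier B} (hl : ∀ x, m.left x = n.left x)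
    (hr : ∀ x, m.right x = n.right x) : m = n :=
  Subtype.ext (Prod.ext (LinearMap.ext hl) (MulOpposite.unop_injective (LinearMap.ext hr)))

/-- The canonical embedding of `B` in `M(B)`. -/
def incl (b : B) : Multiplier B :=
  mk (LinearMap.mulLeft ℂ b) (LinearMap.mulRight ℂ b)
    (fun x y => by simp [mul_assoc]) (fun x y => by simp [mul_assoc])
    (fun x y => by simp [mul_assoc])

theorem incl_injective (hB : NonDegenerate B) : Function.Injective (incl (B := B)) := by
  intro a b hab
  refine sub_eq_zero.mp (hB.eq_zero_of_mul_left _ fun x => ?_)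
  have h : (incl a).left x = (incl b).left x := by rw [hab]
  have h' : a * x = b * x := h
  rw [sub_mul, h', sub_self]

theorem left_mul_left (m n : Multiplier B) (x : B) : (m * n).left x = m.left (n.left x) := rfl

theorem right_mul_right (m n : Multiplier B) (x : B) :
    (m * n).right x = n.right (m.right x) := rfl

theorem mul_incl (m : Multiplier B) (b : B) : m * incl b = incl (m.left b) :=
  ext (fun x => left_mul_apply m b x) (fun x => right_mul m x b)

theorem incl_mul (m : Multiplier B) (b : B) : incl b * m = incl (m.right b) :=
  ext (fun x => (right_mul m b x).symm) (fun x => right_mul_apply m x b)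

end Multiplier

/-- Automorphisms of the complex algebra `B`, which need not have a unit. -/
structure AlgAut (B : Type*) [NonUnitalRing B] [Module ℂ B] extends B ≃ₗ[ℂ] B where
  map_mul' : ∀ x y : B, toFun (x * y) = toFun x * toFun y

namespace AlgAut

instance : CoeFun (AlgAut B) (fun _ => B → B) := ⟨fun θ => θ.toLinearEquiv⟩

theorem map_mul (θ : AlgAut B) (x y : B) : θ (x * y) = θ x * θ y := θ.map_mul' x y

theorem symm_map_mul (θ : AlgAut B) (x y : B) :
    θ.toLinearEquiv.symm (x * y) = θ.toLinearEquiv.symm x * θ.toLinearEquiv.symm y := by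
  apply θ.toLinearEquiv.injective
  have h := θ.map_mul (θ.toLinearEquiv.symm x) (θ.toLinearEquiv.symm y)
  simp only [LinearEquiv.apply_symm_apply] at h ⊢
  exact h.symm

/-- The canonical extension of an automorphism `θ` of `B` to the multiplier algebra: it is
determined by `θ(m) θ(x) = θ(m x)` and `θ(x) θ(m) = θ(x m)` for `x` in `B`. -/
def extend (θ : AlgAut B) (m : Multiplier B) : Multiplier B :=
  Multiplier.mk
    (θ.toLinearEquiv.toLinearMap ∘ₗ m.left ∘ₗ θ.toLinearEquiv.symm.toLinearMap)
    (θ.toLinearEquiv.toLinearMap ∘ₗ m.right ∘ₗ θ.toLinearEquiv.symm.toLinearMap)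
    (fun x y => by
      have h := θ.map_mul (m.left (θ.toLinearEquiv.symm x)) (θ.toLinearEquiv.symm y)
      simp only [LinearEquiv.apply_symm_apply] at h
      simp [symm_map_mul, Multiplier.left_mul_apply, h])
    (fun x y => by
      have h := θ.map_mul (θ.toLinearEquiv.symm x) (m.right (θ.toLinearEquiv.symm y))
      simp only [LinearEquiv.apply_symm_apply] at h
      simp [symm_map_mul, Multiplier.right_mul_apply, h])
    (fun x y => by
      have h := θ.map_mul (m.right (θ.toLinearEquiv.symm x)) (θ.toLinearEquiv.symm y)
      have k := θ.map_mul (θ.toLinearEquiv.symm x) (m.left (θ.toLinearEquiv.symm y))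
      rw [Multiplier.right_mul] at h
      simp only [LinearEquiv.apply_symm_apply] at h k
      simpa using h.symm.trans k)

end AlgAut

end MultiplierAlgebra

/-! ### Tensor products -/

section Tensor

variable {A : Type*} [NonUnitalRing A] [Module ℂ A] [IsScalarTower ℂ A A] [SMulCommClass ℂ A A]

/-- The element `m ⊗ n` of `M(A ⊗ A)`, for `m` and `n` in `M(A)`. -/
def Multiplier.tmul (m n : Multiplier A) : Multiplier (A ⊗[ℂ] A) :=
  Multiplier.mk (TensorProduct.map m.left n.left) (TensorProduct.map m.right n.right)
    (fun x y => by
      induction x with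
      | zero => simp
      | add x x' hx hx' => simp only [add_mul, map_add, hx, hx']
      | tmul a b =>
        induction y with
        | zero => simp
        | add y y' hy hy' => simp only [mul_add, map_add, hy, hy']
        | tmul c d => simp [Multiplier.left_mul_apply])
    (fun x y => by
      induction x with
      | zero => simp
      | add x x' hx hx' => simp only [add_mul, map_add, hx, hx']
      | tmul a b =>
        induction y with
        | zero => simp
        | add y y' hy hy' => simp only [mul_add, map_add, hy, hy']
        | tmul c d => simp [Multiplier.right_mul_apply])
    (fun x y => by
      induction x with
      | zero => simp
      | add x x' hx hx' => simp only [add_mul, map_add, hx, hx']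
      | tmul a b =>
        induction y with
        | zero => simp
        | add y y' hy hy' => simp only [mul_add, map_add, hy, hy']
        | tmul c d => simp [Multiplier.right_mul])

/-- The element `a ⊗ 1` of `M(A ⊗ A)`. -/
def inFst (a : A) : Multiplier (A ⊗[ℂ] A) := Multiplier.tmul (Multiplier.incl a) 1

/-- The element `1 ⊗ a` of `M(A ⊗ A)`. -/
def inSnd (a : A) : Multiplier (A ⊗[ℂ] A) := Multiplier.tmul 1 (Multiplier.incl a)

/-- The automorphism `α ⊗ β` of `A ⊗ A`. -/
def AlgAut.tensor (α β : AlgAut A) : AlgAut (A ⊗[ℂ] A) where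
  toLinearEquiv := TensorProduct.congr α.toLinearEquiv β.toLinearEquiv
  map_mul' x y := by
    change TensorProduct.congr α.toLinearEquiv β.toLinearEquiv (x * y) =
      TensorProduct.congr α.toLinearEquiv β.toLinearEquiv x *
      TensorProduct.congr α.toLinearEquiv β.toLinearEquiv y
    induction x with
    | zero => simp
    | add x x' hx hx' => simp only [add_mul, map_add, hx, hx']
    | tmul a b =>
      induction y with
      | zero => simp
      | add y y' hy hy' => simp only [mul_add, map_add, hy, hy']
      | tmul c d => simp [AlgAut.map_mul]

/-- The map `ι ⊗ f` from `A ⊗ A` to `A`, for a linear functional `f`. -/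
def evalSnd (f : A →ₗ[ℂ] ℂ) : A ⊗[ℂ] A →ₗ[ℂ] A :=
  (TensorProduct.rid ℂ A).toLinearMap ∘ₗ f.lTensor A

/-- The map `f ⊗ ι` from `A ⊗ A` to `A`, for a linear functional `f`. -/
def evalFst (f : A →ₗ[ℂ] ℂ) : A ⊗[ℂ] A →ₗ[ℂ] A :=
  (TensorProduct.lid ℂ A).toLinearMap ∘ₗ f.rTensor A

@[simp] theorem evalSnd_tmul (f : A →ₗ[ℂ] ℂ) (a b : A) : evalSnd f (a ⊗ₜ b) = f b • a := by
  simp [evalSnd]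

@[simp] theorem evalFst_tmul (f : A →ₗ[ℂ] ℂ) (a b : A) : evalFst f (a ⊗ₜ b) = f a • b := by
  simp [evalFst]

theorem inFst_left_tmul (c a b : A) : (inFst c).left (a ⊗ₜ b) = (c * a) ⊗ₜ b := rfl

theorem inFst_right_tmul (c a b : A) : (inFst c).right (a ⊗ₜ b) = (a * c) ⊗ₜ b := rfl

theorem inSnd_left_tmul (c a b : A) : (inSnd c).left (a ⊗ₜ b) = a ⊗ₜ (c * b) := rfl

theorem inSnd_right_tmul (c a b : A) : (inSnd c).right (a ⊗ₜ b) = a ⊗ₜ (b * c) := rfl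

theorem evalSnd_inFst_left (f : A →ₗ[ℂ] ℂ) (c : A) (x : A ⊗[ℂ] A) :
    evalSnd f ((inFst c).left x) = c * evalSnd f x := by
  induction x with
  | zero => simp
  | add x y hx hy => simp only [map_add, mul_add, hx, hy]
  | tmul a b => simp [inFst_left_tmul, mul_smul_comm]

theorem evalSnd_inFst_right (f : A →ₗ[ℂ] ℂ) (c : A) (x : A ⊗[ℂ] A) :
    evalSnd f ((inFst c).right x) = evalSnd f x * c := by
  induction x with
  | zero => simp
  | add x y hx hy => simp only [map_add, add_mul, hx, hy]
  | tmul a b => simp [inFst_right_tmul, smul_mul_assoc]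

theorem evalFst_inSnd_left (f : A →ₗ[ℂ] ℂ) (c : A) (x : A ⊗[ℂ] A) :
    evalFst f ((inSnd c).left x) = c * evalFst f x := by
  induction x with
  | zero => simp
  | add x y hx hy => simp only [map_add, mul_add, hx, hy]
  | tmul a b => simp [inSnd_left_tmul, mul_smul_comm]

theorem evalFst_inSnd_right (f : A →ₗ[ℂ] ℂ) (c : A) (x : A ⊗[ℂ] A) :
    evalFst f ((inSnd c).right x) = evalFst f x * c := by
  induction x with
  | zero => simp
  | add x y hx hy => simp only [map_add, add_mul, hx, hy]
  | tmul a b => simp [inSnd_right_tmul, smul_mul_assoc]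

theorem eq_zero_of_evalFst {x : A ⊗[ℂ] A} (h : ∀ f : A →ₗ[ℂ] ℂ, evalFst f x = 0) : x = 0 := by
  let b := Module.Free.chooseBasis ℂ A
  apply (TensorProduct.equivFinsuppOfBasisLeft (N := A) b).injective
  rw [map_zero]
  ext i
  rw [TensorProduct.equivFinsuppOfBasisLeft_apply]
  exact h (b.coord i)

theorem eq_zero_of_evalSnd {x : A ⊗[ℂ] A} (h : ∀ f : A →ₗ[ℂ] ℂ, evalSnd f x = 0) : x = 0 := by
  let b := Module.Free.chooseBasis ℂ A
  apply (TensorProduct.equivFinsuppOfBasisRight (M := A) b).injective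
  rw [map_zero]
  ext i
  rw [TensorProduct.equivFinsuppOfBasisRight_apply]
  exact h (b.coord i)

theorem tmul_tmul_eq_left (b c : A) (x : A ⊗[ℂ] A) :
    (b ⊗ₜ[ℂ] c) * x = (inFst b).left ((inSnd c).left x) := by
  induction x with
  | zero => simp
  | add x y hx hy => simp only [map_add, mul_add, hx, hy]
  | tmul p q => simp [inFst_left_tmul, inSnd_left_tmul]

theorem tmul_tmul_eq_right (b c : A) (x : A ⊗[ℂ] A) :
    x * (b ⊗ₜ[ℂ] c) = (inSnd c).right ((inFst b).right x) := by
  induction x with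
  | zero => simp
  | add x y hx hy => simp only [map_add, add_mul, hx, hy]
  | tmul p q => simp [inFst_right_tmul, inSnd_right_tmul]

theorem inFst_inSnd_comm (b c : A) : inFst b * inSnd c = inSnd c * inFst b := by
  refine Multiplier.ext (fun x => ?_) (fun x => ?_)
  · rw [Multiplier.left_mul_left, Multiplier.left_mul_left]
    induction x with
    | zero => simp
    | add x y hx hy => simp only [map_add, hx, hy]
    | tmul p q => simp [inFst_left_tmul, inSnd_left_tmul]
  · rw [Multiplier.right_mul_right, Multiplier.right_mul_right]
    induction x with
    | zero => simp
    | add x y hx hy => simp only [map_add, hx, hy]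
    | tmul p q => simp [inFst_right_tmul, inSnd_right_tmul]

theorem NonDegenerate.tensor (hA : NonDegenerate A) : NonDegenerate (A ⊗[ℂ] A) where
  eq_zero_of_mul_left x hx := by
    have key : ∀ b : A, (inFst b).right x = 0 := fun b => eq_zero_of_evalFst fun f =>
      hA.eq_zero_of_mul_left _ fun c => by
        rw [← evalFst_inSnd_right, ← tmul_tmul_eq_right, hx, map_zero]
    exact eq_zero_of_evalSnd fun f => hA.eq_zero_of_mul_left _ fun b => by
      rw [← evalSnd_inFst_right, key, map_zero]
  eq_zero_of_mul_right x hx := by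
    have key : ∀ c : A, (inSnd c).left x = 0 := fun c => eq_zero_of_evalSnd fun f =>
      hA.eq_zero_of_mul_right _ fun b => by
        rw [← evalSnd_inFst_left, ← tmul_tmul_eq_left, hx, map_zero]
    exact eq_zero_of_evalFst fun f => hA.eq_zero_of_mul_right _ fun c => by
      rw [← evalFst_inSnd_left, key, map_zero]

end Tensor

/-! ### Regular multiplier Hopf algebras -/

/-- A regular multiplier Hopf algebra `(A, Δ)` over the complex numbers.

The maps `T₁`, `T₂`, `T₃`, `T₄` express that the multipliers `Δ(a)(1 ⊗ b)`, `(a ⊗ 1)Δ(b)`,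
`Δ(a)(b ⊗ 1)` and `(1 ⊗ a)Δ(b)` lie in `A ⊗ A`, which gives a meaning to the axioms for the counit
and the antipode. Because `A ⊗ A` embeds in `M(A ⊗ A)`, these maps are determined by `Δ`; the
counit `ε` and the antipode `S` are determined by `Δ` as well. -/
structure RegularMultiplierHopfAlgebra (A : Type*) [NonUnitalRing A] [Module ℂ A]
    [IsScalarTower ℂ A A] [SMulCommClass ℂ A A] where
  nonDegenerate : NonDegenerate A
  /-- The coproduct, a homomorphism from `A` to `M(A ⊗ A)`. -/
  Δ : A →ₙₐ[ℂ] Multiplier (A ⊗[ℂ] A)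
  /-- The coproduct is non-degenerate: `Δ(A)(A ⊗ A)` spans `A ⊗ A`, -/
  span_left : Submodule.span ℂ {z | ∃ (a : A) (x : A ⊗[ℂ] A), z = (Δ a).left x} = ⊤
  /-- and so does `(A ⊗ A)Δ(A)`. -/
  span_right : Submodule.span ℂ {z | ∃ (a : A) (x : A ⊗[ℂ] A), z = (Δ a).right x} = ⊤
  /-- `T₁ (a ⊗ b) = Δ(a)(1 ⊗ b)` -/
  T₁ : A ⊗[ℂ] A →ₗ[ℂ] A ⊗[ℂ] A
  incl_T₁ : ∀ a b : A, Multiplier.incl (T₁ (a ⊗ₜ b)) = Δ a * inSnd b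
  /-- `T₂ (a ⊗ b) = (a ⊗ 1)Δ(b)` -/
  T₂ : A ⊗[ℂ] A →ₗ[ℂ] A ⊗[ℂ] A
  incl_T₂ : ∀ a b : A, Multiplier.incl (T₂ (a ⊗ₜ b)) = inFst a * Δ b
  /-- `T₃ (a ⊗ b) = Δ(a)(b ⊗ 1)` -/
  T₃ : A ⊗[ℂ] A →ₗ[ℂ] A ⊗[ℂ] A
  incl_T₃ : ∀ a b : A, Multiplier.incl (T₃ (a ⊗ₜ b)) = Δ a * inFst b
  /-- `T₄ (a ⊗ b) = (1 ⊗ a)Δ(b)` -/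
  T₄ : A ⊗[ℂ] A →ₗ[ℂ] A ⊗[ℂ] A
  incl_T₄ : ∀ a b : A, Multiplier.incl (T₄ (a ⊗ₜ b)) = inSnd a * Δ b
  /-- Coassociativity:
  `(a ⊗ 1 ⊗ 1)(Δ ⊗ ι)(Δ(b)(1 ⊗ c)) = (ι ⊗ Δ)((a ⊗ 1)Δ(b))(1 ⊗ 1 ⊗ c)` in `A ⊗ A ⊗ A`. The left
  hand side is `T₂ ⊗ ι` applied to `a ⊗ Δ(b)(1 ⊗ c)`, and the right hand side is `ι ⊗ T₁` applied
  to `(a ⊗ 1)Δ(b) ⊗ c`. -/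
  coassoc : ∀ a b c : A,
    TensorProduct.assoc ℂ A A A
      (T₂.rTensor A ((TensorProduct.assoc ℂ A A A).symm (a ⊗ₜ[ℂ] T₁ (b ⊗ₜ c)))) =
    T₁.lTensor A (TensorProduct.assoc ℂ A A A (T₂ (a ⊗ₜ b) ⊗ₜ[ℂ] c))
  /-- The counit, a homomorphism from `A` to the complex numbers. -/
  ε : A →ₙₐ[ℂ] ℂ
  /-- `(ε ⊗ ι)(Δ(a)(1 ⊗ b)) = ab` -/
  counit_left : ∀ a b : A, evalFst (ε : A →ₗ[ℂ] ℂ) (T₁ (a ⊗ₜ b)) = a * b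
  /-- `(ι ⊗ ε)((a ⊗ 1)Δ(b)) = ab` -/
  counit_right : ∀ a b : A, evalSnd (ε : A →ₗ[ℂ] ℂ) (T₂ (a ⊗ₜ b)) = a * b
  /-- The antipode, an invertible anti-homomorphism from `A` to `A`. -/
  S : A ≃ₗ[ℂ] A
  S_mul : ∀ a b : A, S (a * b) = S b * S a
  /-- `m(S ⊗ ι)(Δ(a)(1 ⊗ b)) = ε(a)b` -/
  antipode_left : ∀ a b : A,
    LinearMap.mul' ℂ A (S.toLinearMap.rTensor A (T₁ (a ⊗ₜ b))) = ε a • b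
  /-- `m(ι ⊗ S)((a ⊗ 1)Δ(b)) = ε(b)a` -/
  antipode_right : ∀ a b : A,
    LinearMap.mul' ℂ A (S.toLinearMap.lTensor A (T₂ (a ⊗ₜ b))) = ε b • a

namespace RegularMultiplierHopfAlgebra

variable {A : Type*} [NonUnitalRing A] [Module ℂ A] [IsScalarTower ℂ A A] [SMulCommClass ℂ A A]

theorem incl_inj (H : RegularMultiplierHopfAlgebra A) {x y : A ⊗[ℂ] A} (h : Multiplier.incl x = Multiplier.incl y) : x = y :=
  Multiplier.incl_injective H.nonDegenerate.tensor h

theorem inFst_mul (a b : A) : inFst (a * b) = inFst a * inFst b := by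
  refine Multiplier.ext (fun x => ?_) (fun x => ?_)
  · rw [Multiplier.left_mul_left]
    induction x with
    | zero => simp
    | add x y hx hy => simp only [map_add, hx, hy]
    | tmul p q => simp [inFst_left_tmul, mul_assoc]
  · rw [Multiplier.right_mul_right]
    induction x with
    | zero => simp
    | add x y hx hy => simp only [map_add, hx, hy]
    | tmul p q => simp [inFst_right_tmul, mul_assoc]

theorem inSnd_mul (a b : A) : inSnd (a * b) = inSnd a * inSnd b := by
  refine Multiplier.ext (fun x => ?_) (fun x => ?_)
  · rw [Multiplier.left_mul_left]
    induction x with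
    | zero => simp
    | add x y hx hy => simp only [map_add, hx, hy]
    | tmul p q => simp [inSnd_left_tmul, mul_assoc]
  · rw [Multiplier.right_mul_right]
    induction x with
    | zero => simp
    | add x y hx hy => simp only [map_add, hx, hy]
    | tmul p q => simp [inSnd_right_tmul, mul_assoc]

variable (H : RegularMultiplierHopfAlgebra A)

theorem T₁_mul (a b c : A) : H.T₁ (a ⊗ₜ (b * c)) = (inSnd c).right (H.T₁ (a ⊗ₜ b)) :=
  H.incl_inj <| by
    rw [← Multiplier.incl_mul, H.incl_T₁, H.incl_T₁, inSnd_mul, mul_assoc]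

theorem T₂_mul (a b c : A) : H.T₂ ((a * b) ⊗ₜ c) = (inFst a).left (H.T₂ (b ⊗ₜ c)) :=
  H.incl_inj <| by
    rw [← Multiplier.mul_incl, H.incl_T₂, H.incl_T₂, inFst_mul, mul_assoc]

theorem T₃_mul (a b c : A) : H.T₃ (a ⊗ₜ (b * c)) = (inFst c).right (H.T₃ (a ⊗ₜ b)) :=
  H.incl_inj <| by
    rw [← Multiplier.incl_mul, H.incl_T₃, H.incl_T₃, inFst_mul, mul_assoc]

theorem T₄_mul (a b c : A) : H.T₄ ((a * b) ⊗ₜ c) = (inSnd a).left (H.T₄ (b ⊗ₜ c)) :=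
  H.incl_inj <| by
    rw [← Multiplier.mul_incl, H.incl_T₄, H.incl_T₄, inSnd_mul, mul_assoc]

theorem T₂_T₃ (a b c : A) :
    (inFst c).right (H.T₂ (a ⊗ₜ b)) = (inFst a).left (H.T₃ (b ⊗ₜ c)) :=
  H.incl_inj <| by
    rw [← Multiplier.mul_incl, ← Multiplier.incl_mul, H.incl_T₂, H.incl_T₃, mul_assoc]

theorem T₄_T₁ (a b c : A) :
    (inSnd c).right (H.T₄ (a ⊗ₜ b)) = (inSnd a).left (H.T₁ (b ⊗ₜ c)) :=
  H.incl_inj <| by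
    rw [← Multiplier.mul_incl, ← Multiplier.incl_mul, H.incl_T₄, H.incl_T₁, mul_assoc]

/-- The multiplier `(ι ⊗ f)Δ(a)` of `A`, for a linear functional `f`: it is defined by
`((ι ⊗ f)Δ(a)) b = (ι ⊗ f)(Δ(a)(b ⊗ 1))` and `b ((ι ⊗ f)Δ(a)) = (ι ⊗ f)((b ⊗ 1)Δ(a))`. -/
def sliceSnd (f : A →ₗ[ℂ] ℂ) (a : A) : Multiplier A :=
  Multiplier.mk (evalSnd f ∘ₗ H.T₃ ∘ₗ TensorProduct.mk ℂ A A a)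
    (evalSnd f ∘ₗ H.T₂ ∘ₗ (TensorProduct.mk ℂ A A).flip a)
    (fun x y => by simp [T₃_mul, evalSnd_inFst_right])
    (fun x y => by simp [T₂_mul, evalSnd_inFst_left])
    (fun x y => by simp [← evalSnd_inFst_right, ← evalSnd_inFst_left, T₂_T₃])

/-- The multiplier `(f ⊗ ι)Δ(a)` of `A`, for a linear functional `f`: it is defined by
`((f ⊗ ι)Δ(a)) b = (f ⊗ ι)(Δ(a)(1 ⊗ b))` and `b ((f ⊗ ι)Δ(a)) = (f ⊗ ι)((1 ⊗ b)Δ(a))`. -/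
def sliceFst (f : A →ₗ[ℂ] ℂ) (a : A) : Multiplier A :=
  Multiplier.mk (evalFst f ∘ₗ H.T₁ ∘ₗ TensorProduct.mk ℂ A A a)
    (evalFst f ∘ₗ H.T₄ ∘ₗ (TensorProduct.mk ℂ A A).flip a)
    (fun x y => by simp [T₁_mul, evalFst_inSnd_right])
    (fun x y => by simp [T₄_mul, evalFst_inSnd_left])
    (fun x y => by simp [← evalFst_inSnd_right, ← evalFst_inSnd_left, T₄_T₁])

/-- A left integral: a non-zero linear functional with `(ι ⊗ φ)Δ(a) = φ(a)1` in `M(A)`. -/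
structure IsLeftIntegral (φ : A →ₗ[ℂ] ℂ) : Prop where
  ne_zero : φ ≠ 0
  invariant : ∀ a : A, H.sliceSnd φ a = φ a • (1 : Multiplier A)

/-- A right integral: a non-zero linear functional with `(ψ ⊗ ι)Δ(a) = ψ(a)1` in `M(A)`. -/
structure IsRightIntegral (ψ : A →ₗ[ℂ] ℂ) : Prop where
  ne_zero : ψ ≠ 0
  invariant : ∀ a : A, H.sliceFst ψ a = ψ a • (1 : Multiplier A)

/-- The multiplier `δ` is the modular element: `(φ ⊗ ι)Δ(a) = φ(a)δ` for all `a`, where `φ` is a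
left integral. -/
def IsModularElement (φ : A →ₗ[ℂ] ℂ) (δ : Multiplier A) : Prop :=
  ∀ a : A, H.sliceFst φ a = φ a • δ

/-- The automorphism `S²` of `A`. -/
def sqS : AlgAut A where
  toLinearEquiv := H.S.trans H.S
  map_mul' a b := by
    change H.S (H.S (a * b)) = H.S (H.S a) * H.S (H.S b)
    rw [H.S_mul, H.S_mul]

end RegularMultiplierHopfAlgebra

/-- The automorphism `σ` is the modular automorphism of the functional `f`:
`f(ab) = f(bσ(a))` for all `a` and `b`. -/
def IsModularAutomorphism {A : Type*} [NonUnitalRing A] [Module ℂ A] (f : A →ₗ[ℂ] ℂ)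
    (σ : AlgAut A) : Prop :=
  ∀ a b : A, f (a * b) = f (b * σ a)

end AlgQuantumGroup

end

/-! Everything rests on strong left invariance, `S_evalSnd_T₁`: S((ι⊗φ)(Δ(a)(1⊗b))) =
(ι⊗φ)((1⊗a)Δ(b)). Together with `σ` it makes `φ` faithful (`faithful`), so elements of A and of A⊗A
can be compared by testing against `φ`.

Applying strong invariance twice, with `σ` used to move factors across `φ`, produces S² on the first
leg and σ on the second. This is the formula for Δ(σ(a)) (`T₄_modular`, `comul_modular`).

For the other two identities put χ = ψ∘S⁻¹. Strong invariance and right invariance of ψ give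
φ(b·(χ⊗ι)Δ(a)) = ψ(b)φ(a). By faithfulness and the counit, χ = kφ with k ≠ 0. Hence ψ = kφ∘S and
also ψ(b) = kφ(bδ) (`exists_eq_smul_comp_antipode`). Writing ψ(ab) = ψ(bσ'(a)) through either
formula and cancelling by faithfulness gives the two relations between σ and σ'. -/

namespace AlgQuantumGroup

/-! ### Slices of tensors and tests for equality. -/

section Tensor

variable {A : Type*} [NonUnitalRing A] [Module ℂ A] [IsScalarTower ℂ A A] [SMulCommClass ℂ A A]

theorem incl_tmul (a b : A) :
    Multiplier.incl (a ⊗ₜ[ℂ] b) = inFst a * inSnd b :=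
  Multiplier.ext (fun x => tmul_tmul_eq_left a b x) (fun x => tmul_tmul_eq_right a b x)

/-- Since x(my) = (xm)y, non-degeneracy recovers the left multiplication from the right one. -/
theorem Multiplier.ext_right {B : Type*} [NonUnitalRing B] [Module ℂ B] [IsScalarTower ℂ B B]
    [SMulCommClass ℂ B B] (hB : NonDegenerate B) {m n : Multiplier B}
    (h : ∀ x, m.right x = n.right x) : m = n :=
  Multiplier.ext (fun y => sub_eq_zero.mp <| hB.eq_zero_of_mul_right _ fun x => by
    rw [mul_sub, ← Multiplier.right_mul, ← Multiplier.right_mul, h, sub_self]) h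

theorem NonDegenerate.eq_of_mul_left_eq (hA : NonDegenerate A) {a b : A}
    (h : ∀ d, d * a = d * b) : a = b :=
  sub_eq_zero.mp <| hA.eq_zero_of_mul_right _ fun d => by rw [mul_sub, h, sub_self]

theorem NonDegenerate.eq_of_mul_right_eq (hA : NonDegenerate A) {a b : A}
    (h : ∀ d, a * d = b * d) : a = b :=
  sub_eq_zero.mp <| hA.eq_zero_of_mul_left _ fun d => by rw [sub_mul, h, sub_self]

theorem evalSnd_inSnd_right (f : A →ₗ[ℂ] ℂ) (b : A) (x : A ⊗[ℂ] A) :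
    evalSnd f ((inSnd b).right x) = evalSnd (f ∘ₗ LinearMap.mulRight ℂ b) x := by
  induction x with
  | zero => simp
  | add x y hx hy => simp only [map_add, hx, hy]
  | tmul p q => simp [inSnd_right_tmul]

theorem evalSnd_inSnd_left (f : A →ₗ[ℂ] ℂ) (b : A) (x : A ⊗[ℂ] A) :
    evalSnd f ((inSnd b).left x) = evalSnd (f ∘ₗ LinearMap.mulLeft ℂ b) x := by
  induction x with
  | zero => simp
  | add x y hx hy => simp only [map_add, hx, hy]
  | tmul p q => simp [inSnd_left_tmul]

theorem apply_evalSnd (f g : A →ₗ[ℂ] ℂ) (x : A ⊗[ℂ] A) :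
    g (evalSnd f x) = f (evalFst g x) := by
  induction x with
  | zero => simp
  | add x y hx hy => simp only [map_add, hx, hy]
  | tmul p q => simp [mul_comm]

theorem eq_of_evalSnd {x y : A ⊗[ℂ] A} (h : ∀ f : A →ₗ[ℂ] ℂ, evalSnd f x = evalSnd f y) :
    x = y :=
  sub_eq_zero.mp <| eq_zero_of_evalSnd fun f => by rw [map_sub, h, sub_self]

theorem NonDegenerate.eq_of_inFst_left_eq (hA : NonDegenerate A) {x y : A ⊗[ℂ] A}
    (h : ∀ d : A, (inFst d).left x = (inFst d).left y) : x = y :=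
  eq_of_evalSnd fun f => hA.eq_of_mul_left_eq fun d => by
    rw [← evalSnd_inFst_left, ← evalSnd_inFst_left, h]

theorem IsModularAutomorphism.evalSnd_right_eq_left {φ : A →ₗ[ℂ] ℂ} {σ : AlgAut A}
    (hσ : IsModularAutomorphism φ σ) (c : A) (x : A ⊗[ℂ] A) :
    evalSnd φ ((inSnd (σ c)).right x) = evalSnd φ ((inSnd c).left x) := by
  rw [evalSnd_inSnd_right, evalSnd_inSnd_left]
  congr 2
  ext y
  exact (hσ c y).symm

/-- If `φ(zy) = 0` for all `z` and all slices `y` of `x` in the second leg, then every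
"twisted multiplication" followed by `φ` vanishes on `x`. -/
theorem map_mul_eq_zero_of_evalSnd {φ : A →ₗ[ℂ] ℂ} (T : A →ₗ[ℂ] A) {x : A ⊗[ℂ] A}
    (h : ∀ z, evalSnd φ ((inSnd z).left x) = 0) :
    φ (LinearMap.mul' ℂ A (T.rTensor A x)) = 0 := by
  let b := Module.Free.chooseBasis ℂ A
  -- With basis vectors as left legs, the hypothesis splits into one condition for each right leg `c
  -- i`.
  obtain ⟨c, rfl⟩ := TensorProduct.eq_repr_basis_left b x
  have hc : ∀ i z, φ (z * c i) = 0 := by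
    intro i z
    have hz := h z
    simp only [Finsupp.sum, map_sum, inSnd_left_tmul, evalSnd_tmul] at hz
    by_cases hi : i ∈ c.support
    · exact linearIndependent_iff'.mp b.linearIndependent _ _ hz i hi
    · rw [Finsupp.notMem_support_iff.mp hi, mul_zero, map_zero]
  simp only [Finsupp.sum, map_sum, LinearMap.rTensor_tmul, LinearMap.mul'_apply, hc,
    Finset.sum_const_zero]

end Tensor

namespace RegularMultiplierHopfAlgebra

variable {A : Type*} [NonUnitalRing A] [Module ℂ A] [IsScalarTower ℂ A A] [SMulCommClass ℂ A A]
  (H : RegularMultiplierHopfAlgebra A)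

/-! ### Associativity relations among the maps `T₁`, ..., `T₄`. -/

theorem inFst_left_T₁ (d a b : A) :
    (inFst d).left (H.T₁ (a ⊗ₜ b)) = (inSnd b).right (H.T₂ (d ⊗ₜ a)) :=
  H.incl_inj <| by
    rw [← Multiplier.mul_incl, ← Multiplier.incl_mul, H.incl_T₁, H.incl_T₂, mul_assoc]

theorem inFst_left_T₄ (d c a : A) :
    (inFst d).left (H.T₄ (c ⊗ₜ a)) = (inSnd c).left (H.T₂ (d ⊗ₜ a)) :=
  H.incl_inj <| by
    rw [← Multiplier.mul_incl, ← Multiplier.mul_incl, H.incl_T₄, H.incl_T₂, ← mul_assoc,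
      ← mul_assoc, inFst_inSnd_comm]

theorem inSnd_left_T₃ (a b c : A) :
    (inSnd a).left (H.T₃ (b ⊗ₜ c)) = (inFst c).right (H.T₄ (a ⊗ₜ b)) :=
  H.incl_inj <| by
    rw [← Multiplier.mul_incl, ← Multiplier.incl_mul, H.incl_T₄, H.incl_T₃, mul_assoc]

theorem T₃_mul_left (v b c : A) :
    H.T₃ ((v * b) ⊗ₜ c) = (H.Δ v).left (H.T₃ (b ⊗ₜ c)) :=
  H.incl_inj <| by
    rw [← Multiplier.mul_incl, H.incl_T₃, H.incl_T₃, map_mul, mul_assoc]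

theorem Δ_left_tmul (v r s : A) :
    (H.Δ v).left (r ⊗ₜ s) = (inFst r).right (H.T₁ (v ⊗ₜ s)) :=
  H.incl_inj <| by
    rw [← Multiplier.mul_incl, ← Multiplier.incl_mul, H.incl_T₁, incl_tmul, inFst_inSnd_comm,
      mul_assoc]

theorem Δ_right_tmul (a b c : A) :
    (H.Δ a).right (b ⊗ₜ c) = (inFst b).left (H.T₄ (c ⊗ₜ a)) :=
  H.incl_inj <| by
    rw [← Multiplier.mul_incl, ← Multiplier.incl_mul, H.incl_T₄, incl_tmul, mul_assoc]

/-! ### Slices of the coproduct, the counit and coassociativity. -/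

/-- Multiplying by d on the left turns slices of `T₁`, and below of `T₄`, into slices of `T₂`, where
they can be compared and where the factor b is absorbed into the functional. -/
theorem mul_evalSnd_T₁ (f : A →ₗ[ℂ] ℂ) (d a b : A) :
    d * evalSnd f (H.T₁ (a ⊗ₜ b)) = evalSnd (f ∘ₗ LinearMap.mulRight ℂ b) (H.T₂ (d ⊗ₜ a)) := by
  rw [← evalSnd_inFst_left, inFst_left_T₁, evalSnd_inSnd_right]

theorem mul_evalSnd_T₄ (f : A →ₗ[ℂ] ℂ) (d a b : A) :
    d * evalSnd f (H.T₄ (a ⊗ₜ b)) = evalSnd (f ∘ₗ LinearMap.mulLeft ℂ a) (H.T₂ (d ⊗ₜ b)) := by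
  rw [← evalSnd_inFst_left, inFst_left_T₄, evalSnd_inSnd_left]

theorem evalSnd_counit_T₄ (c a : A) :
    evalSnd (H.ε : A →ₗ[ℂ] ℂ) (H.T₄ (c ⊗ₜ a)) = H.ε c • a :=
  H.nonDegenerate.eq_of_mul_left_eq fun d => by
    have h : (H.ε : A →ₗ[ℂ] ℂ) ∘ₗ LinearMap.mulLeft ℂ c = H.ε c • (H.ε : A →ₗ[ℂ] ℂ) := by
      ext y
      simp
    have h' (k : ℂ) (f : A →ₗ[ℂ] ℂ) (x : A ⊗[ℂ] A) : evalSnd (k • f) x = k • evalSnd f x := by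
      simp [evalSnd, LinearMap.lTensor_smul]
    rw [mul_evalSnd_T₄, h, h', counit_right, mul_smul_comm]

theorem counit_evalSnd_T₁ (f : A →ₗ[ℂ] ℂ) (a s : A) :
    H.ε (evalSnd f (H.T₁ (a ⊗ₜ s))) = f (a * s) := by
  rw [← H.counit_left, ← apply_evalSnd]
  rfl

/-- Coassociativity, with a functional applied in the third leg. -/
theorem T₂_evalSnd_T₁ (f : A →ₗ[ℂ] ℂ) (d a s : A) :
    H.T₂ (d ⊗ₜ evalSnd f (H.T₁ (a ⊗ₜ s))) =
      (evalSnd f ∘ₗ H.T₁ ∘ₗ (TensorProduct.mk ℂ A A).flip s).lTensor A (H.T₂ (d ⊗ₜ a)) := by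
  have h := congrArg ((evalSnd f).lTensor A) (H.coassoc d a s)
  have hy (y : A ⊗[ℂ] A) (q : A) :
      (evalSnd f).lTensor A (TensorProduct.assoc ℂ A A A (y ⊗ₜ q)) = f q • y := by
    induction y with
    | zero => simp
    | add y z hy hz => simp only [map_add, TensorProduct.add_tmul, hy, hz, smul_add]
    | tmul u v => simp
  have hl (X : A ⊗[ℂ] A) : (evalSnd f).lTensor A (TensorProduct.assoc ℂ A A A
      (H.T₂.rTensor A ((TensorProduct.assoc ℂ A A A).symm (d ⊗ₜ[ℂ] X)))) =
      H.T₂ (d ⊗ₜ evalSnd f X) := by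
    induction X with
    | zero => simp
    | add x y hx hy => simp only [map_add, TensorProduct.tmul_add, hx, hy]
    | tmul p q =>
      rw [TensorProduct.assoc_symm_tmul, LinearMap.rTensor_tmul, hy]
      simp
  have hr (Y : A ⊗[ℂ] A) : (evalSnd f).lTensor A (H.T₁.lTensor A
      (TensorProduct.assoc ℂ A A A (Y ⊗ₜ[ℂ] s))) =
      (evalSnd f ∘ₗ H.T₁ ∘ₗ (TensorProduct.mk ℂ A A).flip s).lTensor A Y := by
    induction Y with
    | zero => simp
    | add x y hx hy => simp only [map_add, TensorProduct.add_tmul, hx, hy]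
    | tmul p q => simp
  rw [hl, hr] at h
  exact h

/-- The linear map `v ↦ (ι ⊗ f)(Δ(v)x)`. -/
def evalSndΔ (f : A →ₗ[ℂ] ℂ) (x : A ⊗[ℂ] A) : A →ₗ[ℂ] A where
  toFun v := evalSnd f ((H.Δ v).left x)
  map_add' u v := by
    simp only [map_add]
    exact map_add (evalSnd f) ((H.Δ u).left x) ((H.Δ v).left x)
  map_smul' k v := by
    simp only [map_smul]
    exact map_smul (evalSnd f) k ((H.Δ v).left x)

theorem evalSndΔ_apply (f : A →ₗ[ℂ] ℂ) (x : A ⊗[ℂ] A) (v : A) :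
    H.evalSndΔ f x v = evalSnd f ((H.Δ v).left x) := rfl

/-- The linear map `r ⊗ s ↦ Δ((ι ⊗ f)(Δ(a)(1 ⊗ s)))(1 ⊗ r)`. -/
def sliceT₁ (f : A →ₗ[ℂ] ℂ) (a : A) : A ⊗[ℂ] A →ₗ[ℂ] A ⊗[ℂ] A :=
  H.T₁ ∘ₗ (TensorProduct.comm ℂ A A).toLinearMap ∘ₗ
    (evalSnd f ∘ₗ H.T₁ ∘ₗ TensorProduct.mk ℂ A A a).lTensor A

theorem sliceT₁_tmul (f : A →ₗ[ℂ] ℂ) (a r s : A) :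
    H.sliceT₁ f a (r ⊗ₜ s) = H.T₁ (evalSnd f (H.T₁ (a ⊗ₜ s)) ⊗ₜ r) := by
  simp [sliceT₁]

/-- In Sweedler notation both sides at x = r⊗s are d a₁ ⊗ a₂ r f(a₃ s). The right side involves x
only through Δ(v)x, which is what allows the substitution x = Δ(b)(c⊗1). -/
theorem inFst_left_sliceT₁ (f : A →ₗ[ℂ] ℂ) (d a : A) (x : A ⊗[ℂ] A) :
    (inFst d).left (H.sliceT₁ f a x) = (H.evalSndΔ f x).lTensor A (H.T₂ (d ⊗ₜ a)) := by
  induction x with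
  | zero =>
    have : H.evalSndΔ f 0 = 0 := by
      ext v
      simp [evalSndΔ_apply]
    simp [this]
  | add x y hx hy =>
    have : H.evalSndΔ f (x + y) = H.evalSndΔ f x + H.evalSndΔ f y := by
      ext v
      simp [evalSndΔ_apply]
    simp only [map_add, hx, hy, this, LinearMap.lTensor_add, LinearMap.add_apply]
  | tmul r s =>
    rw [sliceT₁_tmul, inFst_left_T₁, T₂_evalSnd_T₁]
    generalize H.T₂ (d ⊗ₜ a) = y
    induction y with
    | zero => simp
    | add x y hx hy => simp only [map_add, hx, hy]
    | tmul u v =>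
      simp [inSnd_right_tmul, evalSndΔ_apply, Δ_left_tmul, evalSnd_inFst_right]

variable {H}

/-! ### Strong left invariance. -/

namespace IsLeftIntegral

variable {φ : A →ₗ[ℂ] ℂ} (hφ : H.IsLeftIntegral φ)
include hφ

theorem evalSnd_T₃ (a b : A) : evalSnd φ (H.T₃ (a ⊗ₜ b)) = φ a • b :=
  congrArg (fun m : Multiplier A => m.left b) (hφ.invariant a)

/-- Here Δ(v)x = Δ(vb)(c⊗1), so left invariance collapses its slice to φ(vb)c. -/
theorem sliceT₁_T₃ (a b c : A) :
    H.sliceT₁ φ a (H.T₃ (b ⊗ₜ c)) = evalSnd φ (H.T₁ (a ⊗ₜ b)) ⊗ₜ c := by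
  refine H.nonDegenerate.eq_of_inFst_left_eq fun d => ?_
  rw [inFst_left_sliceT₁, inFst_left_tmul, mul_evalSnd_T₁]
  generalize H.T₂ (d ⊗ₜ a) = y
  induction y with
  | zero => simp
  | add x y hx hy => simp only [map_add, TensorProduct.add_tmul, hx, hy]
  | tmul u v =>
    simp [evalSndΔ_apply, ← T₃_mul_left, hφ.evalSnd_T₃, TensorProduct.smul_tmul]

/-- Strong left invariance: `S((ι ⊗ φ)(Δ(a)(1 ⊗ b))) = (ι ⊗ φ)((1 ⊗ a)Δ(b))`. -/
theorem S_evalSnd_T₁ (a b : A) :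
    H.S (evalSnd φ (H.T₁ (a ⊗ₜ b))) = evalSnd φ (H.T₄ (a ⊗ₜ b)) := by
  refine H.nonDegenerate.eq_of_mul_right_eq fun c => ?_
  -- The antipode axiom evaluates m(S⊗ι) of `sliceT₁` on every x. At x = Δ(b)(c⊗1), `sliceT₁_T₃`
  -- gives a second value.
  have key (x : A ⊗[ℂ] A) :
      LinearMap.mul' ℂ A (H.S.toLinearMap.rTensor A (H.sliceT₁ φ a x)) =
        evalSnd φ ((inSnd a).left x) := by
    induction x with
    | zero => simp
    | add x y hx hy => simp only [map_add, hx, hy]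
    | tmul r s =>
      rw [sliceT₁_tmul, antipode_left, counit_evalSnd_T₁, inSnd_left_tmul, evalSnd_tmul]
  have h := key (H.T₃ (b ⊗ₜ c))
  rw [hφ.sliceT₁_T₃, inSnd_left_T₃, evalSnd_inFst_right] at h
  simpa using h

/-- If ε were zero, the counit law would make all products vanish, so A = 0 and φ = 0. -/
theorem exists_counit_eq_one : ∃ c, H.ε c = 1 := by
  by_contra! hc
  have h0 (c : A) : H.ε c = 0 := by
    by_contra hne
    exact hc ((H.ε c)⁻¹ • c) (by rw [map_smul, smul_eq_mul, inv_mul_cancel₀ hne])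
  refine hφ.ne_zero (LinearMap.ext fun a => ?_)
  have : a = 0 := H.nonDegenerate.eq_zero_of_mul_left a fun b => by
    have h1 : (H.ε : A →ₗ[ℂ] ℂ) = 0 := LinearMap.ext h0
    rw [← H.counit_left, h1]
    simp [evalFst]
  simp [this]

theorem exists_eq_one : ∃ a, φ a = 1 := by
  obtain ⟨a, ha⟩ := DFunLike.ne_iff.mp hφ.ne_zero
  exact ⟨(φ a)⁻¹ • a, by rw [map_smul, smul_eq_mul, inv_mul_cancel₀ ha]⟩

/-! ### Faithfulness of the left integral. -/

variable {σ : AlgAut A} (hσ : IsModularAutomorphism φ σ)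
include hσ

/-- By σ, also φ(ab) = 0 for all b, so strong invariance kills every (ι⊗φ)(Δ(a)(1⊗w)). Hence φ
annihilates A times the right legs of Δ(a)(1⊗c), and applying φ to the antipode axiom gives ε(a)φ(c)
= 0. -/
theorem counit_eq_zero {a : A} (ha : ∀ b, φ (b * a) = 0) : H.ε a = 0 := by
  have ha' (b : A) : φ (a * b) = 0 := by
    have h := hσ (σ.toLinearEquiv.symm b) a
    rw [ha, LinearEquiv.apply_symm_apply] at h
    exact h.symm
  have hE (w : A) : evalSnd φ (H.T₁ (a ⊗ₜ w)) = 0 := by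
    apply H.S.injective
    rw [hφ.S_evalSnd_T₁, map_zero]
    refine H.nonDegenerate.eq_zero_of_mul_right _ fun d => ?_
    have h0 : φ ∘ₗ LinearMap.mulLeft ℂ a = 0 := LinearMap.ext ha'
    rw [mul_evalSnd_T₄, h0]
    simp [evalSnd]
  obtain ⟨c, hc⟩ := hφ.exists_eq_one
  have h := map_mul_eq_zero_of_evalSnd (φ := φ) H.S.toLinearMap (x := H.T₁ (a ⊗ₜ c)) fun z => by
    rw [← hσ.evalSnd_right_eq_left, ← T₁_mul, hE]
  rwa [antipode_left, map_smul, hc, smul_eq_mul, mul_one] at h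

/-- A left integral with a modular automorphism is faithful. -/
theorem faithful {a : A} (ha : ∀ b, φ (b * a) = 0) : a = 0 := by
  have hF (x : A) : evalSnd φ (H.T₄ (x ⊗ₜ a)) = 0 := by
    have h0 : φ ∘ₗ LinearMap.mulRight ℂ a = 0 := LinearMap.ext ha
    have hE : evalSnd φ (H.T₁ (x ⊗ₜ a)) = 0 :=
      H.nonDegenerate.eq_zero_of_mul_right _ fun d => by
        rw [mul_evalSnd_T₁, h0]
        simp [evalSnd]
    rw [← hφ.S_evalSnd_T₁, hE, map_zero]
  refine H.nonDegenerate.eq_zero_of_mul_right _ fun d => ?_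
  rw [← Module.forall_dual_apply_eq_zero_iff ℂ]
  intro g
  rw [← H.counit_right, apply_evalSnd]
  -- Each slice (g⊗ι)((d⊗1)Δ(a)) inherits the vanishing property of a; its counit is g(da), so da =
  -- 0.
  refine hφ.counit_eq_zero hσ fun b => ?_
  rw [← evalFst_inSnd_left, ← inFst_left_T₄, ← apply_evalSnd, evalSnd_inFst_left, hF, mul_zero,
    map_zero]

theorem eq_of_forall_mul {a a' : A} (h : ∀ b, φ (b * a) = φ (b * a')) : a = a' :=
  sub_eq_zero.mp <| hφ.faithful hσ fun b => by rw [mul_sub, map_sub, h, sub_self]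

theorem eq_of_forall_evalSnd_inSnd_left {x y : A ⊗[ℂ] A}
    (h : ∀ b, evalSnd φ ((inSnd b).left x) = evalSnd φ ((inSnd b).left y)) : x = y :=
  sub_eq_zero.mp <| eq_zero_of_evalFst fun g => hφ.faithful hσ fun b => by
    rw [← evalFst_inSnd_left, ← apply_evalSnd, map_sub, map_sub, h, sub_self, map_zero]

/-! ### The coproduct of the modular automorphism. -/

theorem evalSnd_T₁_modular (a b : A) :
    evalSnd φ (H.T₁ (b ⊗ₜ σ a)) = evalSnd φ (H.T₄ (a ⊗ₜ b)) :=
  H.nonDegenerate.eq_of_mul_left_eq fun d => by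
    rw [mul_evalSnd_T₁, mul_evalSnd_T₄, ← evalSnd_inSnd_right, ← evalSnd_inSnd_left,
      hσ.evalSnd_right_eq_left]

/-- Testing with (ι⊗φ)((1⊗b)·), strong invariance, the modular property and strong invariance again
turn the left side into S²((ι⊗φ)(Δ(a)(1⊗bσ(c)))). Moving σ(c) back across φ gives
S²((ι⊗φ)((1⊗c)Δ(a)(1⊗b))), which is the right side by φ(qb) = φ(bσ(q)). -/
theorem T₄_modular (c a : A) :
    H.T₄ (σ c ⊗ₜ σ a) = (H.sqS.tensor σ) (H.T₄ (c ⊗ₜ a)) := by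
  refine hφ.eq_of_forall_evalSnd_inSnd_left hσ fun b => ?_
  rw [← T₄_mul, ← hφ.S_evalSnd_T₁, hφ.evalSnd_T₁_modular hσ, ← hφ.S_evalSnd_T₁, T₁_mul,
    hσ.evalSnd_right_eq_left, ← T₄_T₁]
  generalize H.T₄ (c ⊗ₜ a) = x
  induction x with
  | zero => simp
  | add x y hx hy => simp only [map_add, hx, hy]
  | tmul p q =>
    have h : (H.sqS.tensor σ) (p ⊗ₜ[ℂ] q) = H.S (H.S p) ⊗ₜ σ q := rfl
    rw [h, inSnd_right_tmul, inSnd_left_tmul, evalSnd_tmul, evalSnd_tmul, hσ q b, map_smul,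
      map_smul]

theorem comul_modular (a : A) : H.Δ (σ a) = (H.sqS.tensor σ).extend (H.Δ a) := by
  refine Multiplier.ext_right H.nonDegenerate.tensor fun x => ?_
  obtain ⟨x, rfl⟩ := (H.sqS.tensor σ).toLinearEquiv.surjective x
  have h : ((H.sqS.tensor σ).extend (H.Δ a)).right ((H.sqS.tensor σ).toLinearEquiv x) =
      (H.sqS.tensor σ) ((H.Δ a).right x) := by
    change (H.sqS.tensor σ).toLinearEquiv ((H.Δ a).right ((H.sqS.tensor σ).toLinearEquiv.symm _)) =
      _
    rw [LinearEquiv.symm_apply_apply]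
  rw [h]
  clear h
  induction x with
  | zero => simp
  | add x y hx hy => simp only [map_add, hx, hy]
  | tmul b c =>
    have hs : (H.sqS.tensor σ).toLinearEquiv (b ⊗ₜ[ℂ] c) = H.sqS b ⊗ₜ σ c := rfl
    rw [hs, Δ_right_tmul, Δ_right_tmul, hφ.T₄_modular hσ]
    generalize H.T₄ (c ⊗ₜ a) = y
    induction y with
    | zero => simp
    | add x y hx hy => simp only [map_add, hx, hy]
    | tmul p q =>
      have ht (u v : A) : (H.sqS.tensor σ) (u ⊗ₜ[ℂ] v) = H.sqS u ⊗ₜ σ v := rfl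
      rw [inFst_left_tmul, ht, ht, inFst_left_tmul, AlgAut.map_mul]

/-! ### Comparison of right and left integrals. -/

/-- Right integrals are multiples of `φ ∘ S`. -/
theorem exists_eq_smul_comp_antipode {ψ : A →ₗ[ℂ] ℂ} (hψ : H.IsRightIntegral ψ) :
    ∃ k : ℂ, k ≠ 0 ∧ (∀ a, ψ a = k * φ (H.S a)) ∧
      ∀ δ, H.IsModularElement φ δ → ∀ b, ψ b = k * φ (δ.right b) := by
  set χ : A →ₗ[ℂ] ℂ := ψ ∘ₗ H.S.symm.toLinearMap with hχ
  -- Strong invariance produces an S that cancels the S⁻¹ in χ, leaving the right invariance of ψ.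
  have hm (a b : A) : φ ((H.sliceFst χ a).right b) = ψ b * φ a := by
    change φ (evalFst χ (H.T₄ (b ⊗ₜ a))) = _
    have hinv : evalFst ψ (H.T₁ (b ⊗ₜ a)) = ψ b • a :=
      congrArg (fun m : Multiplier A => m.left a) (hψ.invariant b)
    rw [← apply_evalSnd, ← hφ.S_evalSnd_T₁]
    simp [hχ, apply_evalSnd, hinv]
  obtain ⟨e, he⟩ := hφ.exists_eq_one
  obtain ⟨c, hc⟩ := hφ.exists_counit_eq_one
  have hε (a : A) : H.ε ((H.sliceFst χ a).right c) = χ a := by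
    change (H.ε : A →ₗ[ℂ] ℂ) (evalFst χ (H.T₄ (c ⊗ₜ a))) = _
    rw [← apply_evalSnd, evalSnd_counit_T₄, hc, one_smul]
  -- By `hm` the two sides agree under φ(b·). Applying ε, with ε(c) = 1, then yields χ = χ(e)φ.
  have hs (a : A) : (H.sliceFst χ a).right c = φ a • (H.sliceFst χ e).right c :=
    hφ.eq_of_forall_mul hσ fun b => by
      rw [← Multiplier.right_mul_apply, hm, mul_smul_comm, ← Multiplier.right_mul_apply, map_smul,
        hm, he, smul_eq_mul, mul_one, mul_comm]
  set k := χ e with hk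
  have hkφ (a : A) : χ a = k * φ a := by
    rw [← hε a, hs, map_smul, hε, smul_eq_mul, mul_comm]
  have hψk (a : A) : ψ a = k * φ (H.S a) := by
    rw [← hkφ]
    simp [hχ]
  refine ⟨k, fun h0 => hψ.ne_zero (LinearMap.ext fun a => by simp [hψk, h0]), hψk,
    fun δ hδ b => ?_⟩
  -- Since φ(e) = 1 and χ = kφ, the multiplier (χ⊗ι)Δ(e) is kδ.
  have h := hm e b
  rw [he, mul_one] at h
  rw [← h]
  have hr : (H.sliceFst φ e).right b = δ.right b := by
    rw [hδ e, he, one_smul]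
  have hχφ : χ = k • φ := LinearMap.ext hkφ
  have hl : (H.sliceFst χ e).right b = k • (H.sliceFst φ e).right b := by
    change evalFst χ (H.T₄ (b ⊗ₜ e)) = k • evalFst φ (H.T₄ (b ⊗ₜ e))
    rw [hχφ]
    simp [evalFst, LinearMap.rTensor_smul]
  rw [hl, map_smul, hr, smul_eq_mul]

end IsLeftIntegral

end RegularMultiplierHopfAlgebra

end AlgQuantumGroup

/-! ### The three identities. -/

open AlgQuantumGroup in
theorem proposition3p4 {A : Type*} [NonUnitalRing A] [Module ℂ A] [IsScalarTower ℂ A A]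
    [SMulCommClass ℂ A A] (H : RegularMultiplierHopfAlgebra A)
    (φ ψ : A →ₗ[ℂ] ℂ) (hφ : H.IsLeftIntegral φ) (hψ : H.IsRightIntegral ψ)
    (σ σ' : AlgAut A) (hσ : IsModularAutomorphism φ σ) (hσ' : IsModularAutomorphism ψ σ')
    (δ : Multiplier A) (hδ : H.IsModularElement φ δ) :
    (∀ a : A, σ (H.S (σ' a)) = H.S a) ∧
    (∀ a : A, δ * Multiplier.incl (σ a) = Multiplier.incl (σ' a) * δ) ∧
    (∀ a : A, H.Δ (σ a) = (H.sqS.tensor σ).extend (H.Δ a)) := by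
  obtain ⟨k, hk, hS, hδ'⟩ := hφ.exists_eq_smul_comp_antipode hσ hψ
  refine ⟨fun a => ?_, fun a => ?_, hφ.comul_modular hσ⟩
  · refine hφ.eq_of_forall_mul hσ fun b => ?_
    obtain ⟨b, rfl⟩ := H.S.surjective b
    refine mul_left_cancel₀ hk ?_
    -- Up to the factor k, both sides become ψ(ab) via ψ = kφ∘S.
    rw [← hσ, ← H.S_mul, ← H.S_mul, ← hS, ← hS, ← hσ']
  · rw [Multiplier.mul_incl, Multiplier.incl_mul]
    congr 1
    refine hφ.eq_of_forall_mul hσ fun b => mul_left_cancel₀ hk ?_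
    -- Here φ(bδσ(a)) = φ(abδ), and ψ = kφ(·δ) reduces the claim to ψ(ab) = ψ(bσ'(a)).
    rw [← Multiplier.right_mul, ← hσ, ← Multiplier.right_mul_apply, ← Multiplier.right_mul_apply,
      ← hδ' δ hδ, ← hδ' δ hδ, hσ']
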